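/- **Theorem 3.1 (weak Favard theorem for orthogonal trigonometric polynomials).** For a nontrivial probability measure $\mu$ on the unit circle $\partial\mathbb D$ (that is, a probability measure with infinite support), apply the Gram–Schmidt procedure with respect to the real inner product $\langle f,g\rangle_{\mathbb R}=\int_{\partial\mathbb D} fg\,d\mu$ to the ordered system $$1,\ \sin\theta,\ \cos\theta,\ \sin 2\theta,\ \cos 2\theta,\ \ldots\qquad (z=e^{i\theta}),$$ without normalizing, so that each function of the system has the orthogonal projections on its predecessors subtracted from it. For $n\ge 1$ let $b_n(\mu)$ and $a_n(\mu)$ be the norms of the resulting "monic" orthogonal functions with leading terms $\sin n\theta$ and $\cos n\theta$ respectively, write the first of these functions as $b_n(\mu)\pi_n$ (so $\|\pi_n\|=1$), and put $\beta_n(\mu)=\langle \cos n\theta,\ b_n(\mu)^{-1}\pi_n\rangle_{\mathbb R}$. By convention $a_0(\mu)=b_0(\mu)=1$ and $\beta_0(\mu)=0$. Let $(a_n,b_n,\beta_n)_{n\ge 0}$ be real triples with $a_0=b_0=1$, $\beta_0=0$ and $a_n,b_n>0$ for all $n\ge 0$, such that $$\bigl[a_n^2+b_n^2(1+\beta_n^2)\bigr]\bigl[a_{n+1}^2+b_{n+1}^2(1+\beta_{n+1}^2)\bigr]<4a_n^2b_n^2\qquad\text{for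 all } n\ge 0,$$ and such that moreover $$a_1^2+b_1^2(1+\beta_1^2)\le 1 .$$ Then there is a nontrivial probability measure $\mu$ on $\partial\mathbb D$ with $a_n(\mu)=a_n$, $b_n(\mu)=b_n$ and $\beta_n(\mu)=\beta_n$ for all $n\ge 0$. This measure is not unique. -/

import Mathlib

open MeasureTheory

noncomputable section

namespace OTP

/-- The unit circle with its Borel measurable structure. -/
instance instMeasurableSpaceCircle : MeasurableSpace Circle := borel Circle

instance instBorelSpaceCircle : BorelSpace Circle := ⟨rfl⟩

/-- The function `(z ^ n + z⁻¹ ^ n) / 2` on the unit circle, which is `cos (n θ)` at `z = e ^ (i θ)`. -/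
def cosFn (n : ℕ) (z : Circle) : ℝ := ((z : ℂ) ^ n).re

/-- The function `(z ^ n - z⁻¹ ^ n) / (2 i)` on the unit circle, which is `sin (n θ)` at
`z = e ^ (i θ)`. -/
def sinFn (n : ℕ) (z : Circle) : ℝ := ((z : ℂ) ^ n).im

theorem cosFn_eq (n : ℕ) (z : Circle) :
    (cosFn n z : ℂ) = ((z : ℂ) ^ n + ((z : ℂ)⁻¹) ^ n) / 2 := by
  rw [← Circle.coe_inv, Circle.coe_inv_eq_conj, ← map_pow, cosFn, Complex.re_eq_add_conj]

theorem sinFn_eq (n : ℕ) (z : Circle) :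
    (sinFn n z : ℂ) = ((z : ℂ) ^ n - ((z : ℂ)⁻¹) ^ n) / (2 * Complex.I) := by
  rw [← Circle.coe_inv, Circle.coe_inv_eq_conj, ← map_pow, sinFn, Complex.im_eq_sub_conj]

/-- The ordered real trigonometric system `1, sin θ, cos θ, sin 2θ, cos 2θ, …`, enumerated from `0`:
the entry `2 n` is `cos (n θ)` and the entry `2 n + 1` is `sin ((n + 1) θ)`. -/
def trigSystem (k : ℕ) : Circle → ℝ :=
  if k % 2 = 0 then cosFn (k / 2) else sinFn ((k + 1) / 2)

/-- The real inner product `∫ f g dμ`. -/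
def realInner (μ : Measure Circle) (f g : Circle → ℝ) : ℝ := ∫ z, f z * g z ∂μ

/-- The norm `(∫ |f| ^ 2 dμ) ^ (1 / 2)`. -/
def realNorm (μ : Measure Circle) (f : Circle → ℝ) : ℝ := Real.sqrt (∫ z, |f z| ^ 2 ∂μ)

/-- The (unnormalized) Gram-Schmidt procedure applied to the trigonometric system: the `k`-th
"monic" orthogonal function is the `k`-th entry of the system minus its projections on the earlier
orthogonal functions. -/
def monicOTP (μ : Measure Circle) (k : ℕ) : Circle → ℝ :=
  trigSystem k - ∑ j : Fin k,
    (realInner μ (trigSystem k) (monicOTP μ j) / realInner μ (monicOTP μ j) (monicOTP μ j)) •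
      monicOTP μ j
termination_by k
decreasing_by all_goals exact j.2

/-- The coefficient `a_n`: the norm of the monic orthogonal function with leading term `cos (n θ)`;
`a_0 = 1` by convention. -/
def coeffA (μ : Measure Circle) (n : ℕ) : ℝ :=
  if n = 0 then 1 else realNorm μ (monicOTP μ (2 * n))

/-- The coefficient `b_n`: the norm of the monic orthogonal function with leading term `sin (n θ)`;
`b_0 = 1` by convention. -/
def coeffB (μ : Measure Circle) (n : ℕ) : ℝ :=
  if n = 0 then 1 else realNorm μ (monicOTP μ (2 * n - 1))

/-- The orthonormal trigonometric polynomial `π_n`, so that `b_n π_n` is monic with leading term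
`sin (n θ)`; `π_0 = 0` by convention. -/
def orthoPi (μ : Measure Circle) (n : ℕ) : Circle → ℝ :=
  if n = 0 then 0 else (coeffB μ n)⁻¹ • monicOTP μ (2 * n - 1)

/-- The coefficient `β_n = ⟨cos (n θ), b_n⁻¹ π_n⟩`; it is `0` for `n = 0`, since `π_0 = 0`. -/
def coeffBeta (μ : Measure Circle) (n : ℕ) : ℝ :=
  realInner μ (cosFn n) ((coeffB μ n)⁻¹ • orthoPi μ n)

/-- A nontrivial probability measure on the unit circle: one whose support is infinite. -/
def IsNontrivialProbability (μ : Measure Circle) : Prop :=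
  IsProbabilityMeasure μ ∧ μ.support.Infinite

/-- `μ` is a nontrivial probability measure on the unit circle whose coefficients are exactly the
given ones. -/
def HasCoefficients (μ : Measure Circle) (a b β : ℕ → ℝ) : Prop :=
  IsNontrivialProbability μ ∧
    ∀ n : ℕ, coeffA μ n = a n ∧ coeffB μ n = b n ∧ coeffBeta μ n = β n

end OTP

end

open Polynomial ComplexConjugate

open Filter Topology

/-! The problem is translated to Verblunsky coefficients. If `μ` has coefficients `α` and monic
Szegő polynomials `Φ`, then `z⁻ⁿ Φ_{2n+1}(z)` has leading term `z ^ (n + 1)` and is orthogonal to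
every trigonometric polynomial of degree at most `n`. Its imaginary and real parts are therefore
`sin ((n + 1) θ)` and `cos ((n + 1) θ)` with their projections on the earlier functions removed,
except for the projection of the cosine on the sine.

With `h = ∏ k < 2n+1, (1 - |α k|²)` and `α = α (2n+1)`, the Gram matrix of these two parts is `h/2`
times `[[1 - Re α, -Im α], [-Im α, 1 + Re α]]`. One Gram-Schmidt step identifies it with `[[b²,
b²β], [b²β, a² + b²β²]]` at index `n + 1` (`coeff_of_szegoMoment`). Its trace gives `h = T (n+1)`,
where `T = a² + b²(1 + β²)`; the entries then give `α (2n+1)`, and the determinant gives `1 - |α|² =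
4a²b²/T²`.

The even coefficients enter only through `h`: passing from `T (n+1)` to `T (n+2)` forces `1 - |α
(2n+2)|² = T (n+1) T (n+2) / (4a²b²)`, and `1 - |α 0|² = T 1`. The inequalities put these values in
`(0, 1]`; at `n = 0` the product inequality says only `T 1 < 2`, which is why `T 1 ≤ 1` is assumed
separately. Every sequence in the open disk is realized by a measure (`exists_measure_szegoMoment`),
which gives existence. The arguments of the even coefficients are free, and strict inequality makes
`α 2` nonzero, so changing its sign gives a second measure. -/

/-! ### Szegő polynomials. -/

/-- The Szegő recursion with Verblunsky coefficients `α`: the pair of the monic polynomial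
`Φ n` and its reversal. -/
noncomputable def szegoPair (α : ℕ → ℂ) : ℕ → ℂ[X] × ℂ[X]
  | 0 => (1, 1)
  | n + 1 =>
    (X * (szegoPair α n).1 - C (conj (α n)) * (szegoPair α n).2,
      (szegoPair α n).2 - C (α n) * (X * (szegoPair α n).1))

/-- The monic Szegő polynomial of degree `n` with Verblunsky coefficients `α`. -/
noncomputable def szegoPoly (α : ℕ → ℂ) (n : ℕ) : ℂ[X] := (szegoPair α n).1

/-- The reversed Szegő polynomial. -/
noncomputable def szegoRev (α : ℕ → ℂ) (n : ℕ) : ℂ[X] := (szegoPair α n).2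

theorem szegoPoly_zero (α : ℕ → ℂ) : szegoPoly α 0 = 1 := rfl

theorem szegoRev_zero (α : ℕ → ℂ) : szegoRev α 0 = 1 := rfl

theorem szegoPoly_succ (α : ℕ → ℂ) (n : ℕ) :
    szegoPoly α (n + 1) = X * szegoPoly α n - C (conj (α n)) * szegoRev α n := rfl

theorem szegoRev_succ (α : ℕ → ℂ) (n : ℕ) :
    szegoRev α (n + 1) = szegoRev α n - C (α n) * (X * szegoPoly α n) := rfl

theorem szegoPair_congr {α α' : ℕ → ℂ} {n : ℕ} (h : ∀ k < n, α k = α' k) :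
    szegoPair α n = szegoPair α' n := by
  induction n with
  | zero => rfl
  | succ n ih => simp only [szegoPair, ih fun k hk => h k (by omega), h n n.lt_succ_self]

theorem szego_degree (α : ℕ → ℂ) (n : ℕ) :
    (szegoPoly α n).Monic ∧ (szegoPoly α n).natDegree = n ∧ (szegoRev α n).natDegree ≤ n := by
  induction n with
  | zero => simp [szegoPoly_zero, szegoRev_zero]
  | succ n ih =>
    obtain ⟨hm, hd, hr⟩ := ih
    have hXm : (X * szegoPoly α n).Monic := monic_X.mul hm
    have hXd : (X * szegoPoly α n).natDegree = n + 1 := by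
      rw [natDegree_X_mul hm.ne_zero, hd]
    have hC : (C (conj (α n)) * szegoRev α n).natDegree < (X * szegoPoly α n).natDegree := by
      have := natDegree_C_mul_le (conj (α n)) (szegoRev α n)
      omega
    have hC' := degree_lt_degree hC
    refine ⟨hXm.sub_of_left hC', ?_, ?_⟩
    · rw [szegoPoly_succ, natDegree_sub_eq_left_of_natDegree_lt hC, hXd]
    · rw [szegoRev_succ]
      refine (natDegree_sub_le _ _).trans (max_le (by omega) ?_)
      exact (natDegree_C_mul_le _ _).trans hXd.le

theorem szegoPoly_monic (α : ℕ → ℂ) (n : ℕ) : (szegoPoly α n).Monic := (szego_degree α n).1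

theorem szegoPoly_natDegree (α : ℕ → ℂ) (n : ℕ) : (szegoPoly α n).natDegree = n :=
  (szego_degree α n).2.1

/-- The squared norms `∏ k < n, (1 - |α k|²)` of the Szegő polynomials. -/
noncomputable def szegoNormSq (α : ℕ → ℂ) (n : ℕ) : ℝ := ∏ k ∈ Finset.range n, (1 - ‖α k‖ ^ 2)

theorem szegoNormSq_succ (α : ℕ → ℂ) (n : ℕ) :
    szegoNormSq α (n + 1) = szegoNormSq α n * (1 - ‖α n‖ ^ 2) := Finset.prod_range_succ _ _

theorem szegoNormSq_pos {α : ℕ → ℂ} (hα : ∀ n, ‖α n‖ < 1) (n : ℕ) : 0 < szegoNormSq α n :=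
  Finset.prod_pos fun k _ => by nlinarith [hα k, norm_nonneg (α k)]

/-! ### Moments and orthogonality relations. -/

/-- The nonnegatively indexed moments determined by the Verblunsky coefficients `α`. -/
noncomputable def szegoMomentNat (α : ℕ → ℂ) : ℕ → ℂ
  | 0 => 1
  | n + 1 => -∑ k : Fin (n + 1), (szegoPoly α (n + 1)).coeff k * szegoMomentNat α k

/-- The moments determined by the Verblunsky coefficients `α`. -/
noncomputable def szegoMoment (α : ℕ → ℂ) : ℤ → ℂ
  | .ofNat n => szegoMomentNat α n
  | .negSucc n => conj (szegoMomentNat α (n + 1))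

theorem szegoMoment_zero (α : ℕ → ℂ) : szegoMoment α 0 = 1 := by
  change szegoMomentNat α 0 = 1
  rw [szegoMomentNat]

theorem szegoMoment_natCast (α : ℕ → ℂ) (n : ℕ) : szegoMoment α n = szegoMomentNat α n := rfl

theorem szegoMoment_neg (α : ℕ → ℂ) (k : ℤ) : szegoMoment α (-k) = conj (szegoMoment α k) := by
  rcases k with n | n
  · rcases n with _ | n
    · simp [szegoMoment_zero]
    · rfl
  · change szegoMomentNat α (n + 1) = conj (conj (szegoMomentNat α (n + 1)))
    rw [Complex.conj_conj]

/-- For a moment sequence `c`, the functional `p ↦ ∫ z⁻ʲ p(z)`. -/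
noncomputable def momentFunctional (c : ℤ → ℂ) (j : ℤ) : ℂ[X] →ₗ[ℂ] ℂ :=
  (basisMonomials ℂ).constr ℂ fun k => c (k - j)

theorem momentFunctional_X_pow (c : ℤ → ℂ) (j : ℤ) (k : ℕ) :
    momentFunctional c j (X ^ k) = c (k - j) := by
  have := (basisMonomials ℂ).constr_basis ℂ (fun k : ℕ => c (k - j)) k
  simpa [momentFunctional, coe_basisMonomials, monomial_one_right_eq_X_pow] using this

theorem momentFunctional_eq_sum (c : ℤ → ℂ) (j : ℤ) (p : ℂ[X]) {N : ℕ} (hN : p.natDegree < N) :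
    momentFunctional c j p = ∑ k ∈ Finset.range N, p.coeff k * c (k - j) := by
  conv_lhs => rw [p.as_sum_range' N hN]
  simp_rw [← C_mul_X_pow_eq_monomial, ← smul_eq_C_mul, map_sum, map_smul, momentFunctional_X_pow,
    smul_eq_mul]

theorem momentFunctional_C_mul (c : ℤ → ℂ) (j : ℤ) (a : ℂ) (p : ℂ[X]) :
    momentFunctional c j (C a * p) = a * momentFunctional c j p := by
  rw [← smul_eq_C_mul, map_smul, smul_eq_mul]

theorem momentFunctional_X_mul (c : ℤ → ℂ) (j : ℤ) (p : ℂ[X]) :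
    momentFunctional c j (X * p) = momentFunctional c (j - 1) p := by
  induction p using Polynomial.induction_on' with
  | add p q hp hq => rw [mul_add, map_add, map_add, hp, hq]
  | monomial n a =>
    rw [← C_mul_X_pow_eq_monomial, mul_left_comm, ← pow_succ', momentFunctional_C_mul,
      momentFunctional_C_mul, momentFunctional_X_pow, momentFunctional_X_pow]
    congr 2
    push_cast
    ring

/-- On the circle the reversed polynomial is `zⁿ` times the conjugate of `Φ n`. Since the reversal
is defined by recursion here, its consequence for moments is proved by induction. -/
theorem momentFunctional_szegoRev (α : ℕ → ℂ) (n : ℕ) (j : ℤ) :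
    momentFunctional (szegoMoment α) j (szegoRev α n) =
      conj (momentFunctional (szegoMoment α) (n - j) (szegoPoly α n)) := by
  induction n generalizing j with
  | zero =>
    have h := fun i => momentFunctional_X_pow (szegoMoment α) i 0
    simp only [pow_zero, Nat.cast_zero, zero_sub] at h
    simp [szegoPoly_zero, szegoRev_zero, h, szegoMoment_neg]
  | succ n ih =>
    simp only [szegoRev_succ, szegoPoly_succ, map_sub, momentFunctional_C_mul,
      momentFunctional_X_mul, ih, map_mul, Complex.conj_conj]
    congr 3 <;> push_cast <;> ring_nf

/-- The moment `c (n + 1)` was chosen to make exactly this hold, `Φ (n + 1)` being monic. -/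
theorem momentFunctional_zero_szegoPoly_succ (α : ℕ → ℂ) (n : ℕ) :
    momentFunctional (szegoMoment α) 0 (szegoPoly α (n + 1)) = 0 := by
  rw [momentFunctional_eq_sum (N := n + 2) _ _ _ (by rw [szegoPoly_natDegree]; omega),
    Finset.sum_range_succ]
  have hc : (szegoPoly α (n + 1)).coeff (n + 1) = 1 := by
    have := (szegoPoly_monic α (n + 1)).coeff_natDegree
    rwa [szegoPoly_natDegree] at this
  simp only [sub_zero, szegoMoment_natCast, hc, one_mul]
  conv_lhs => enter [2]; rw [szegoMomentNat]
  rw [Finset.sum_range, add_neg_cancel]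

/-- Only the case `j = 0` is built into the moments. For `j + 1`, the recursion reduces to the
functionals of indices `j` and `n - (j + 1)` on `Φ n`, both below `n`. -/
theorem momentFunctional_szegoPoly_eq_zero (α : ℕ → ℂ) {n j : ℕ} (hj : j < n) :
    momentFunctional (szegoMoment α) j (szegoPoly α n) = 0 := by
  induction n generalizing j with
  | zero => omega
  | succ n ih =>
    rcases j with _ | j
    · exact momentFunctional_zero_szegoPoly_succ α n
    · have h1 := ih (j := j) (by omega)
      have h2 := ih (j := n - (j + 1)) (by omega)
      rw [Nat.cast_sub (by omega)] at h2
      rw [szegoPoly_succ, map_sub, momentFunctional_C_mul, momentFunctional_X_mul,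
        momentFunctional_szegoRev, h2, Nat.cast_succ, add_sub_cancel_right, h1]
      simp

/-- The mean of `Φ (n + 1)` vanishes, so the two terms of the recursion have equal means. This is
how `α n` is read off from the moments. -/
theorem momentFunctional_szegoPoly_neg_one_aux (α : ℕ → ℂ) (n : ℕ) :
    momentFunctional (szegoMoment α) (-1) (szegoPoly α n) =
      conj (α n) * conj (momentFunctional (szegoMoment α) n (szegoPoly α n)) := by
  have h := momentFunctional_zero_szegoPoly_succ α n
  rw [szegoPoly_succ, map_sub, momentFunctional_C_mul, momentFunctional_X_mul,
    momentFunctional_szegoRev, zero_sub, sub_zero] at h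
  exact sub_eq_zero.1 h

theorem momentFunctional_szegoPoly_self (α : ℕ → ℂ) (n : ℕ) :
    momentFunctional (szegoMoment α) n (szegoPoly α n) = szegoNormSq α n := by
  induction n with
  | zero =>
    have h := momentFunctional_X_pow (szegoMoment α) 0 0
    simpa [szegoPoly_zero, szegoNormSq, szegoMoment_zero] using h
  | succ n ih =>
    rw [szegoPoly_succ, map_sub, momentFunctional_C_mul, momentFunctional_X_mul,
      momentFunctional_szegoRev]
    push_cast
    rw [add_sub_cancel_right, show (n : ℤ) - (n + 1) = -1 by ring,
      momentFunctional_szegoPoly_neg_one_aux, ih, szegoNormSq_succ]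
    have : conj (α n) * α n = ((‖α n‖ ^ 2 : ℝ) : ℂ) := by
      rw [Complex.conj_mul']; push_cast; rfl
    simp only [map_mul, Complex.conj_conj, Complex.conj_ofReal]
    push_cast at this ⊢
    linear_combination (-(szegoNormSq α n : ℂ)) * this

theorem momentFunctional_szegoPoly_neg_one (α : ℕ → ℂ) (n : ℕ) :
    momentFunctional (szegoMoment α) (-1) (szegoPoly α n) = conj (α n) * szegoNormSq α n := by
  rw [momentFunctional_szegoPoly_neg_one_aux, momentFunctional_szegoPoly_self, Complex.conj_ofReal]

/-! ### Positivity of the Toeplitz form. -/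

/-- The Toeplitz form `∑ j k, conj (p j) * q k * c (k - j)` on the coefficients of polynomials of
degree less than `N`. -/
noncomputable def toeplitzForm (c : ℤ → ℂ) (N : ℕ) (p q : ℂ[X]) : ℂ :=
  ∑ j ∈ Finset.range N, conj (p.coeff j) * momentFunctional c j q

theorem toeplitzForm_conj {c : ℤ → ℂ} (hc : ∀ k, c (-k) = conj (c k)) {N : ℕ} {p q : ℂ[X]}
    (hp : p.natDegree < N) (hq : q.natDegree < N) :
    toeplitzForm c N p q = conj (toeplitzForm c N q p) := by
  simp only [toeplitzForm, momentFunctional_eq_sum c _ p hp, momentFunctional_eq_sum c _ q hq,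
    map_sum, map_mul, Complex.conj_conj, Finset.mul_sum, ← hc]
  rw [Finset.sum_comm]
  refine Finset.sum_congr rfl fun j _ => Finset.sum_congr rfl fun k _ => ?_
  rw [neg_sub]
  ring

/-- Splitting off the leading coefficient as a multiple of `Φ n` leaves a remainder of lower degree
orthogonal to `Φ n`, and Pythagoras gives `|x|² h n` plus the form of the remainder. The size `N`
stays fixed while the degree bound `n` varies. -/
theorem toeplitzForm_szegoMoment_nonneg {α : ℕ → ℂ} (hα : ∀ n, ‖α n‖ < 1) (n N : ℕ) (hN : n ≤ N)
    (p : ℂ[X]) (hp : p.degree < n) :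
    ∃ r : ℝ, 0 ≤ r ∧ toeplitzForm (szegoMoment α) N p p = r := by
  induction n generalizing p with
  | zero =>
    have : p = 0 := by simpa using hp
    exact ⟨0, le_rfl, by simp [this, toeplitzForm]⟩
  | succ n ih =>
    set Φ := szegoPoly α n
    set x := p.coeff n
    set q := p - C x * Φ
    have hΦn : Φ.coeff n = 1 := by
      have := (szegoPoly_monic α n).coeff_natDegree
      rwa [szegoPoly_natDegree] at this
    have hq : q.degree < n := by
      rw [degree_lt_iff_coeff_zero]
      intro m hm
      rcases hm.eq_or_lt with rfl | hm
      · simp [q, hΦn, x]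
      · have h1 : p.coeff m = 0 := coeff_eq_zero_of_degree_lt
          (hp.trans_le (by exact_mod_cast hm))
        have h2 : Φ.coeff m = 0 := coeff_eq_zero_of_natDegree_lt
          (by rw [szegoPoly_natDegree]; exact hm)
        simp [q, h1, h2]
    obtain ⟨r, hr, hqr⟩ := ih (by omega) q hq
    have hqN : q.natDegree < N := by
      rcases eq_or_ne q 0 with h0 | h0
      · rw [h0, natDegree_zero]; omega
      · have := (natDegree_lt_iff_degree_lt h0).2 hq; omega
    have hpq : p = C x * Φ + q := by simp [q]
    have hΦN : Φ.natDegree < N := by rw [szegoPoly_natDegree]; omega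
    have hzero : ∀ s : ℂ[X], s.degree < n + 1 →
        toeplitzForm (szegoMoment α) N s Φ = conj (s.coeff n) * szegoNormSq α n := by
      intro s hs
      rw [toeplitzForm, Finset.sum_eq_single n]
      · rw [momentFunctional_szegoPoly_self]
      · intro j _ hjn
        rcases lt_or_gt_of_ne hjn with h | h
        · rw [momentFunctional_szegoPoly_eq_zero α h, mul_zero]
        · rw [coeff_eq_zero_of_degree_lt (hs.trans_le (by exact_mod_cast h))]
          simp
      · intro h
        exact absurd (Finset.mem_range.2 (by omega)) h
    have h1 : toeplitzForm (szegoMoment α) N q Φ = 0 := by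
      rw [hzero q (hq.trans (by exact_mod_cast n.lt_succ_self)), coeff_eq_zero_of_degree_lt hq]
      simp
    have h2 : toeplitzForm (szegoMoment α) N Φ q = 0 := by
      rw [toeplitzForm_conj (szegoMoment_neg α) hΦN hqN, h1, map_zero]
    have h3 : toeplitzForm (szegoMoment α) N Φ Φ = szegoNormSq α n := by
      rw [hzero Φ, hΦn, map_one, one_mul]
      rw [degree_eq_natDegree (szegoPoly_monic α n).ne_zero, szegoPoly_natDegree]
      exact_mod_cast n.lt_succ_self
    refine ⟨‖x‖ ^ 2 * szegoNormSq α n + r, ?_, ?_⟩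
    · have := (szegoNormSq_pos hα n).le
      positivity
    · have hexp : toeplitzForm (szegoMoment α) N p p =
          conj x * x * toeplitzForm (szegoMoment α) N Φ Φ +
          conj x * toeplitzForm (szegoMoment α) N Φ q +
          x * toeplitzForm (szegoMoment α) N q Φ + toeplitzForm (szegoMoment α) N q q := by
        rw [hpq]
        simp only [toeplitzForm, map_add, momentFunctional_C_mul, coeff_add, coeff_C_mul, map_mul,
          Finset.mul_sum, ← Finset.sum_add_distrib]
        exact Finset.sum_congr rfl fun j _ => by ring
      rw [hexp, h1, h2, h3, hqr, Complex.conj_mul']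
      push_cast
      ring

/-! ### Herglotz's theorem by Fejér means and weak compactness. -/

/-- The normalized Haar measure on the unit circle, transported from `ℝ / ℤ`. -/
noncomputable def circleHaar : Measure Circle :=
  (AddCircle.haarAddCircle (T := (1 : ℝ))).map AddCircle.toCircle

instance : IsProbabilityMeasure circleHaar :=
  Measure.isProbabilityMeasure_map AddCircle.continuous_toCircle.measurable.aemeasurable

theorem continuous_circle_zpow (m : ℤ) : Continuous fun z : Circle => (z : ℂ) ^ m := by
  have : (fun z : Circle => (z : ℂ) ^ m) = fun z => ((z ^ m : Circle) : ℂ) := by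
    funext z; rw [Circle.coe_zpow]
  rw [this]
  exact continuous_subtype_val.comp (continuous_zpow m)

theorem integrable_of_continuous_circle {E : Type*} [NormedAddCommGroup E]
    {μ : Measure Circle} [IsFiniteMeasure μ] {f : Circle → E} (hf : Continuous f) :
    Integrable f μ :=
  hf.integrable_of_hasCompactSupport (HasCompactSupport.of_compactSpace f)

theorem integral_circleHaar_zpow (m : ℤ) :
    ∫ z, (z : ℂ) ^ m ∂circleHaar = if m = 0 then 1 else 0 := by
  rw [circleHaar, integral_map AddCircle.continuous_toCircle.measurable.aemeasurable
    (continuous_circle_zpow m).aestronglyMeasurable]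
  have h := fourierCoeff_fourier (T := (1 : ℝ)) m
  have h0 := congrFun h 0
  simp only [fourierCoeff, Pi.single_apply, neg_zero, fourier_apply,
    AddCircle.toCircle_zsmul, Circle.coe_zpow, zpow_zero, Circle.coe_one, one_smul] at h0
  rw [h0]
  simp only [eq_comm]

/-- Counts the pairs of indices on one diagonal of an `N × N` Toeplitz matrix: the source of the
Fejér weights. -/
theorem card_filter_sub_eq (m : ℤ) (N : ℕ) :
    ∑ k ∈ Finset.range N, ∑ j ∈ Finset.range N, (if (k : ℤ) - j = m then (1 : ℂ) else 0) =
      ((N - m.natAbs : ℕ) : ℂ) := by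
  have inner : ∀ k : ℕ, ∑ j ∈ Finset.range N, (if (k : ℤ) - j = m then (1 : ℂ) else 0) =
      if m ≤ k ∧ k < N + m then 1 else 0 := by
    intro k
    by_cases h : m ≤ k ∧ k < N + m
    · rw [if_pos h, Finset.sum_eq_single (k - m).toNat]
      · rw [if_pos (by omega)]
      · intro j _ hj
        rw [if_neg (by omega)]
      · intro hj
        rw [Finset.mem_range] at hj
        omega
    · rw [if_neg h]
      refine Finset.sum_eq_zero fun j hj => ?_
      rw [Finset.mem_range] at hj
      rw [if_neg (by omega)]
  simp only [inner, Finset.sum_boole]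
  congr 1
  rcases m.natAbs_eq with hm | hm
  · have : (Finset.range N).filter (fun k : ℕ => m ≤ k ∧ k < N + m) = Finset.Ico m.natAbs N := by
      ext k; simp only [Finset.mem_filter, Finset.mem_range, Finset.mem_Ico]; omega
    rw [this, Nat.card_Ico]
  · have : (Finset.range N).filter (fun k : ℕ => m ≤ k ∧ k < N + m) =
        Finset.range (N - m.natAbs) := by
      ext k; simp only [Finset.mem_filter, Finset.mem_range]; omega
    rw [this, Finset.card_range]

/-- The Fejér means of the Fourier series with coefficients `c`, up to normalization. -/
noncomputable def fejerSum (c : ℤ → ℂ) (N : ℕ) (z : Circle) : ℂ :=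
  ∑ k ∈ Finset.range N, ∑ j ∈ Finset.range N, c (k - j) * (z : ℂ) ^ ((j : ℤ) - k)

theorem continuous_fejerSum (c : ℤ → ℂ) (N : ℕ) : Continuous (fejerSum c N) :=
  continuous_finsetSum _ fun _ _ => continuous_finsetSum _ fun _ _ =>
    continuous_const.mul (continuous_circle_zpow _)

theorem integral_zpow_mul_fejerSum (c : ℤ → ℂ) (N : ℕ) (m : ℤ) :
    ∫ z, (z : ℂ) ^ m * fejerSum c N z ∂circleHaar = ((N - m.natAbs : ℕ) : ℂ) * c m := by
  have hint : ∀ k j : ℕ, ∀ z : Circle, (z : ℂ) ^ m * (c (k - j) * (z : ℂ) ^ ((j : ℤ) - k)) =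
      c (k - j) * (z : ℂ) ^ (m + j - k) := by
    intro k j z
    rw [mul_left_comm, ← zpow_add₀ z.coe_ne_zero, add_sub_assoc]
  simp only [fejerSum, Finset.mul_sum, hint]
  have hcont : ∀ (a : ℂ) (n : ℤ), Continuous fun z : Circle => a * (z : ℂ) ^ n := fun a n =>
    continuous_const.mul (continuous_circle_zpow n)
  rw [integral_finsetSum _ fun k _ => integrable_of_continuous_circle
    (continuous_finsetSum _ fun j _ => hcont _ _),
    ← card_filter_sub_eq, Finset.sum_mul]
  refine Finset.sum_congr rfl fun k _ => ?_
  rw [integral_finsetSum _ fun j _ => integrable_of_continuous_circle (hcont _ _), Finset.sum_mul]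
  refine Finset.sum_congr rfl fun j _ => ?_
  rw [integral_const_mul, integral_circleHaar_zpow]
  by_cases h : (k : ℤ) - j = m
  · rw [if_pos (by omega), if_pos h, h, one_mul, mul_one]
  · rw [if_neg (by omega), if_neg h, zero_mul, mul_zero]

/-- A probability measure on the circle whose moments are those of a given positive semidefinite
Toeplitz sequence, damped by Fejér weights. -/
theorem exists_probabilityMeasure_fejer {c : ℤ → ℂ} (hc0 : c 0 = 1)
    (hc : ∀ (N : ℕ) (x : ℕ → ℂ), ∃ r : ℝ, 0 ≤ r ∧
      ∑ k ∈ Finset.range N, ∑ j ∈ Finset.range N, conj (x j) * x k * c (k - j) = r) (N : ℕ) :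
    ∃ μ : ProbabilityMeasure Circle, ∀ m : ℤ,
      ∫ z, (z : ℂ) ^ m ∂(μ : Measure Circle) =
        ((N + 1 - m.natAbs : ℕ) : ℂ) / (N + 1 : ℕ) * c m := by
  have hpos : ∀ z : Circle, ∃ r : ℝ, 0 ≤ r ∧ fejerSum c (N + 1) z = r := by
    intro z
    -- The Fejér sum at `z` is the Toeplitz form evaluated at the vector `x k = z⁻ᵏ`.
    obtain ⟨r, hr, h⟩ := hc (N + 1) fun k => (z : ℂ) ^ (-(k : ℤ))
    refine ⟨r, hr, ?_⟩
    rw [← h, fejerSum]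
    refine Finset.sum_congr rfl fun k _ => Finset.sum_congr rfl fun j _ => ?_
    rw [map_zpow₀, ← Circle.coe_inv_eq_conj, Circle.coe_inv, inv_zpow', neg_neg,
      ← zpow_add₀ z.coe_ne_zero, mul_comm, sub_eq_add_neg]
  set D : Circle → ℝ := fun z => (fejerSum c (N + 1) z).re / (N + 1 : ℕ) with hD
  have hD0 : ∀ z, 0 ≤ D z := by
    intro z
    obtain ⟨r, hr, h⟩ := hpos z
    simp only [hD, h, Complex.ofReal_re]
    positivity
  have hDc : ∀ z, (D z : ℂ) = fejerSum c (N + 1) z / (N + 1 : ℕ) := by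
    intro z
    obtain ⟨r, hr, h⟩ := hpos z
    simp only [hD, h, Complex.ofReal_re]
    push_cast
    rfl
  have hcont : Continuous D :=
    (Complex.continuous_re.comp (continuous_fejerSum c (N + 1))).div_const _
  have hint : ∀ m : ℤ, ∫ z, (D z : ℂ) * (z : ℂ) ^ m ∂circleHaar =
      ((N + 1 - m.natAbs : ℕ) : ℂ) / (N + 1 : ℕ) * c m := by
    intro m
    rw [div_mul_eq_mul_div, ← integral_zpow_mul_fejerSum, ← integral_div]
    refine integral_congr_ae (Eventually.of_forall fun z => ?_)
    simp only [hDc]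
    ring
  have hmass : ∫ z, D z ∂circleHaar = 1 := by
    have h := hint 0
    simp only [zpow_zero, mul_one, hc0, Int.natAbs_zero, Nat.sub_zero] at h
    rw [div_self (by exact_mod_cast N.succ_ne_zero), integral_complex_ofReal] at h
    exact_mod_cast h
  have hprob : IsProbabilityMeasure (circleHaar.withDensity fun z => ENNReal.ofReal (D z)) := by
    constructor
    rw [withDensity_apply _ MeasurableSet.univ, setLIntegral_univ,
      ← ofReal_integral_eq_lintegral_ofReal (integrable_of_continuous_circle hcont)
      (Eventually.of_forall hD0), hmass, ENNReal.ofReal_one]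
  refine ⟨⟨_, hprob⟩, fun m => ?_⟩
  rw [← hint, ProbabilityMeasure.coe_mk, integral_withDensity_eq_integral_toReal_smul
    hcont.measurable.ennreal_ofReal (Eventually.of_forall fun z => ENNReal.ofReal_lt_top)]
  refine integral_congr_ae (Eventually.of_forall fun z => ?_)
  simp only [ENNReal.toReal_ofReal (hD0 z), Complex.real_smul]

/-- **Herglotz's theorem**: a normalized positive semidefinite Toeplitz sequence is the moment
sequence of a probability measure on the unit circle. -/
theorem exists_probabilityMeasure_moments {c : ℤ → ℂ} (hc0 : c 0 = 1)
    (hc : ∀ (N : ℕ) (x : ℕ → ℂ), ∃ r : ℝ, 0 ≤ r ∧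
      ∑ k ∈ Finset.range N, ∑ j ∈ Finset.range N, conj (x j) * x k * c (k - j) = r) :
    ∃ μ : Measure Circle, IsProbabilityMeasure μ ∧ ∀ m : ℤ, ∫ z, (z : ℂ) ^ m ∂μ = c m := by
  choose ν hν using exists_probabilityMeasure_fejer hc0 hc
  -- Probability measures on the circle form a weakly compact space, so the measures converge along
  -- an ultrafilter; the weights `1 - |m| / (N + 1)` tend to `1`.
  set U : Ultrafilter ℕ := hyperfilter ℕ
  obtain ⟨μ, -, hμ⟩ := isCompact_univ.ultrafilter_le_nhds (U.map ν) (by simp)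
  refine ⟨μ, inferInstance, fun m => ?_⟩
  have h1 := (ProbabilityMeasure.tendsto_iff_forall_integral_rclike_tendsto ℂ).1
    (show Tendsto ν U (𝓝 μ) from hμ)
    (BoundedContinuousFunction.mkOfCompact ⟨_, continuous_circle_zpow m⟩)
  simp only [BoundedContinuousFunction.mkOfCompact_apply, ContinuousMap.coe_mk, hν] at h1
  refine tendsto_nhds_unique h1 (Tendsto.mono_left ?_ Nat.hyperfilter_le_atTop)
  have h2 : Tendsto (fun N : ℕ => (1 - (m.natAbs : ℂ) * (1 / ((N : ℂ) + 1))) * c m) atTop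
      (𝓝 ((1 - (m.natAbs : ℂ) * 0) * c m)) :=
    ((tendsto_one_div_add_atTop_nhds_zero_nat (𝕜 := ℂ)).const_mul _ |>.const_sub _).mul_const _
  rw [mul_zero, sub_zero, one_mul] at h2
  refine h2.congr' ?_
  filter_upwards [eventually_ge_atTop m.natAbs] with N hN
  have hN1 : ((N : ℂ) + 1) ≠ 0 := by exact_mod_cast N.succ_ne_zero
  rw [Nat.cast_sub (by omega)]
  push_cast
  field_simp

/-! ### Gram-Schmidt for the trigonometric system. -/

namespace OTP

theorem continuous_cosFn (n : ℕ) : Continuous (cosFn n) :=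
  Complex.continuous_re.comp (continuous_circle_zpow n)

theorem continuous_sinFn (n : ℕ) : Continuous (sinFn n) :=
  Complex.continuous_im.comp (continuous_circle_zpow n)

theorem trigSystem_zero : trigSystem 0 = cosFn 0 := rfl

theorem trigSystem_even (n : ℕ) : trigSystem (2 * n) = cosFn n := by
  rw [trigSystem, if_pos (by omega)]
  congr 1
  omega

theorem trigSystem_odd (n : ℕ) : trigSystem (2 * n + 1) = sinFn (n + 1) := by
  rw [trigSystem, if_neg (by omega)]
  congr 1
  omega

theorem continuous_trigSystem (k : ℕ) : Continuous (trigSystem k) := by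
  rw [trigSystem]
  split_ifs
  exacts [continuous_cosFn _, continuous_sinFn _]

/-- The span of the first `k` functions of the trigonometric system. -/
def trigSpan (k : ℕ) : Submodule ℝ (Circle → ℝ) :=
  Submodule.span ℝ (trigSystem '' Set.Iio k)

theorem trigSystem_mem_trigSpan {j k : ℕ} (h : j < k) : trigSystem j ∈ trigSpan k :=
  Submodule.subset_span ⟨j, h, rfl⟩

theorem trigSpan_mono {j k : ℕ} (h : j ≤ k) : trigSpan j ≤ trigSpan k :=
  Submodule.span_mono (Set.image_mono (Set.Iio_subset_Iio h))

theorem realInner_comm (μ : Measure Circle) (f g : Circle → ℝ) :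
    realInner μ f g = realInner μ g f := by
  simp only [realInner, mul_comm]

theorem realInner_smul_right (μ : Measure Circle) (f g : Circle → ℝ) (c : ℝ) :
    realInner μ f (c • g) = c * realInner μ f g := by
  simp only [realInner, Pi.smul_apply, smul_eq_mul, mul_left_comm _ c]
  exact integral_const_mul _ _

section Inner

variable {μ : Measure Circle} [IsFiniteMeasure μ] {f g h : Circle → ℝ}

theorem realInner_add_right (hf : Continuous f) (hg : Continuous g) (hh : Continuous h) :
    realInner μ f (g + h) = realInner μ f g + realInner μ f h := by
  simp only [realInner, Pi.add_apply, mul_add]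
  exact integral_add (integrable_of_continuous_circle (hf.mul hg))
    (integrable_of_continuous_circle (hf.mul hh))

theorem realInner_sub_right (hf : Continuous f) (hg : Continuous g) (hh : Continuous h) :
    realInner μ f (g - h) = realInner μ f g - realInner μ f h := by
  simp only [realInner, Pi.sub_apply, mul_sub]
  exact integral_sub (integrable_of_continuous_circle (hf.mul hg))
    (integrable_of_continuous_circle (hf.mul hh))

theorem realInner_sum_right {ι : Type*} (s : Finset ι) {w : ι → Circle → ℝ} (hf : Continuous f)
    (hw : ∀ i, Continuous (w i)) :
    realInner μ f (∑ i ∈ s, w i) = ∑ i ∈ s, realInner μ f (w i) := by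
  simp only [realInner, Finset.sum_apply, Finset.mul_sum]
  exact integral_finsetSum _ fun i _ => integrable_of_continuous_circle (hf.mul (hw i))

theorem realInner_eq_zero_of_mem_trigSpan (hf : Continuous f) {k : ℕ}
    (horth : ∀ j < k, realInner μ f (trigSystem j) = 0) (hg : g ∈ trigSpan k) :
    realInner μ f g = 0 := by
  suffices Continuous g ∧ realInner μ f g = 0 from this.2
  induction hg using Submodule.span_induction with
  | mem x hx =>
    obtain ⟨j, hj, rfl⟩ := hx
    exact ⟨continuous_trigSystem j, horth j hj⟩
  | zero => exact ⟨continuous_const, by simp [realInner]⟩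
  | add x y _ _ hx hy =>
    exact ⟨hx.1.add hy.1, by rw [realInner_add_right hf hx.1 hy.1, hx.2, hy.2, add_zero]⟩
  | smul c x _ hx => exact ⟨hx.1.const_smul c, by rw [realInner_smul_right, hx.2, mul_zero]⟩

theorem realInner_self_eq_trigSystem (hf : Continuous f) {k : ℕ}
    (horth : ∀ j < k, realInner μ f (trigSystem j) = 0) (hspan : f - trigSystem k ∈ trigSpan k) :
    realInner μ f f = realInner μ f (trigSystem k) := by
  rw [← sub_eq_zero, ← realInner_sub_right hf hf (continuous_trigSystem k)]
  exact realInner_eq_zero_of_mem_trigSpan hf horth hspan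

/-- The outcome of the Gram-Schmidt procedure is characterized by its leading terms and its
orthogonality to the preceding functions. -/
theorem monicOTP_eq {W : ℕ → Circle → ℝ} (hcont : ∀ k, Continuous (W k))
    (hspan : ∀ k, W k - trigSystem k ∈ trigSpan k)
    (horth : ∀ k, ∀ j < k, realInner μ (W k) (trigSystem j) = 0)
    (hpos : ∀ k, realInner μ (W k) (trigSystem k) ≠ 0) (k : ℕ) : monicOTP μ k = W k := by
  have hself : ∀ k, realInner μ (W k) (W k) ≠ 0 := fun k => by
    rw [realInner_self_eq_trigSystem (hcont k) (horth k) (hspan k)]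
    exact hpos k
  have hWmem : ∀ j k, j < k → W j ∈ trigSpan k := fun j k hjk => by
    rw [← sub_add_cancel (W j) (trigSystem j)]
    exact add_mem (trigSpan_mono hjk.le (hspan j)) (trigSystem_mem_trigSpan hjk)
  have hWlt : ∀ j k, j < k → realInner μ (W k) (W j) = 0 := fun j k hjk =>
    realInner_eq_zero_of_mem_trigSpan (hcont k) (horth k) (hWmem j k hjk)
  have hWne : ∀ i j, i ≠ j → realInner μ (W i) (W j) = 0 := fun i j hij => by
    rcases lt_or_gt_of_ne hij with h | h
    · rw [realInner_comm, hWlt i j h]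
    · exact hWlt j i h
  -- The unitriangular relation between `W` and the trigonometric system is inverted.
  have htrig : ∀ j k, j < k → trigSystem j ∈ Submodule.span ℝ (W '' Set.Iio k) := by
    intro j
    induction j using Nat.strong_induction_on with
    | _ j ih =>
      intro k hjk
      have hle : trigSpan j ≤ Submodule.span ℝ (W '' Set.Iio k) := by
        refine Submodule.span_le.2 ?_
        rintro _ ⟨i, hi, rfl⟩
        exact ih i hi k (lt_trans hi hjk)
      rw [← sub_sub_cancel (W j) (trigSystem j)]
      exact sub_mem (Submodule.subset_span ⟨j, hjk, rfl⟩) (hle (hspan j))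
  induction k using Nat.strong_induction_on with
  | _ k ih =>
    have hmem : trigSystem k - W k ∈ Submodule.span ℝ (Set.range fun j : Fin k => W j) := by
      have hle : trigSpan k ≤ Submodule.span ℝ (Set.range fun j : Fin k => W j) := by
        refine Submodule.span_le.2 ?_
        rintro _ ⟨i, hi, rfl⟩
        refine Submodule.span_mono ?_ (htrig i k hi)
        rintro _ ⟨j, hj, rfl⟩
        exact ⟨⟨j, hj⟩, rfl⟩
      rw [← neg_sub]
      exact neg_mem (hle (hspan k))
    obtain ⟨d, hd⟩ := Submodule.mem_span_range_iff_exists_fun ℝ |>.1 hmem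
    have hk : trigSystem k = W k + ∑ j : Fin k, d j • W j := by rw [hd, add_sub_cancel]
    have hsum : Continuous (∑ j : Fin k, d j • W j) := by
      rw [Finset.sum_fn]
      exact continuous_finsetSum _ fun j _ => (hcont j).const_smul _
    -- Orthogonality of the `W j` makes the expansion coefficients of `trigSystem k` equal to the
    -- Gram-Schmidt projection coefficients.
    have hproj : ∀ j : Fin k, realInner μ (trigSystem k) (W j) / realInner μ (W j) (W j) = d j := by
      intro j
      rw [realInner_comm, hk, realInner_add_right (hcont j) (hcont k) hsum,
        realInner_sum_right _ (hcont j) fun i : Fin k => (hcont i).const_smul (d i),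
        hWne _ _ j.2.ne, zero_add, Finset.sum_eq_single j, realInner_smul_right,
        mul_div_cancel_right₀ _ (hself j)]
      · intro i _ hij
        rw [realInner_smul_right, hWne _ _ fun h => hij (Fin.ext h.symm), mul_zero]
      · simp
    rw [monicOTP]
    simp only [fun j : Fin k => ih j j.2, hproj]
    rw [hk, add_sub_cancel_right]

end Inner

theorem re_zpow_eq_cosFn (m : ℤ) (z : Circle) : ((z : ℂ) ^ m).re = cosFn m.natAbs z := by
  rcases m.natAbs_eq with h | h
  · conv_lhs => rw [h]
    rfl
  · conv_lhs => rw [h]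
    rw [zpow_neg, ← inv_zpow, ← Circle.coe_inv, Circle.coe_inv_eq_conj, ← map_zpow₀,
      Complex.conj_re]
    rfl

theorem im_zpow_eq_sinFn (m : ℤ) (z : Circle) :
    ((z : ℂ) ^ m).im = m.sign * sinFn m.natAbs z := by
  rcases lt_trichotomy m 0 with h | rfl | h
  · rw [Int.sign_eq_neg_one_of_neg h]
    have h : m = -(m.natAbs : ℤ) := by omega
    conv_lhs => rw [h]
    rw [zpow_neg, ← inv_zpow, ← Circle.coe_inv, Circle.coe_inv_eq_conj, ← map_zpow₀,
      Complex.conj_im, sinFn, zpow_natCast, Int.cast_neg, Int.cast_one, neg_one_mul]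
  · simp
  · rw [Int.sign_eq_one_of_pos h]
    have h : m = (m.natAbs : ℤ) := by omega
    conv_lhs => rw [h]
    rw [sinFn, zpow_natCast, Int.cast_one, one_mul]

theorem cosFn_mem_trigSpan {k n : ℕ} (h : k ≤ n) : cosFn k ∈ trigSpan (2 * n + 1) := by
  rw [← trigSystem_even]
  exact trigSystem_mem_trigSpan (by omega)

theorem sinFn_mem_trigSpan {k n : ℕ} (h : k ≤ n) : sinFn k ∈ trigSpan (2 * n + 1) := by
  rcases k with _ | k
  · have : sinFn 0 = 0 := by funext z; simp [sinFn]
    rw [this]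
    exact zero_mem _
  · rw [← trigSystem_odd]
    exact trigSystem_mem_trigSpan (by omega)

/-- Serves for the lower terms of `z⁻ⁿ Φ_{2n+1}(z)`, whose exponents `k - n` with `0 ≤ k ≤ 2n` all
lie between `-n` and `n`. -/
theorem re_im_mul_zpow_mem_trigSpan (w : ℂ) {m : ℤ} {n : ℕ} (h : m.natAbs ≤ n) :
    (fun z : Circle => (w * (z : ℂ) ^ m).re) ∈ trigSpan (2 * n + 1) ∧
      (fun z : Circle => (w * (z : ℂ) ^ m).im) ∈ trigSpan (2 * n + 1) := by
  have hc := cosFn_mem_trigSpan h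
  have hs := sinFn_mem_trigSpan h
  constructor
  · have : (fun z : Circle => (w * (z : ℂ) ^ m).re) =
        w.re • cosFn m.natAbs - (w.im * m.sign) • sinFn m.natAbs := by
      funext z
      simp only [Complex.mul_re, re_zpow_eq_cosFn, im_zpow_eq_sinFn, Pi.sub_apply, Pi.smul_apply,
        smul_eq_mul]
      ring
    rw [this]
    exact sub_mem (Submodule.smul_mem _ _ hc) (Submodule.smul_mem _ _ hs)
  · have : (fun z : Circle => (w * (z : ℂ) ^ m).im) =
        (w.re * m.sign) • sinFn m.natAbs + w.im • cosFn m.natAbs := by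
      funext z
      simp only [Complex.mul_im, re_zpow_eq_cosFn, im_zpow_eq_sinFn, Pi.add_apply, Pi.smul_apply,
        smul_eq_mul]
      ring
    rw [this]
    exact add_mem (Submodule.smul_mem _ _ hs) (Submodule.smul_mem _ _ hc)

theorem continuous_circle_eval (p : ℂ[X]) : Continuous fun z : Circle => p.eval (z : ℂ) :=
  p.continuous.comp continuous_subtype_val

theorem integral_zpow_mul_eval {μ : Measure Circle} [IsFiniteMeasure μ] {c : ℤ → ℂ}
    (hc : ∀ m : ℤ, ∫ z, (z : ℂ) ^ m ∂μ = c m) (j : ℤ) (p : ℂ[X]) :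
    ∫ z, (z : ℂ) ^ (-j) * p.eval (z : ℂ) ∂μ = momentFunctional c j p := by
  have hcont : ∀ (a : ℂ) (n : ℤ), Continuous fun z : Circle => a * (z : ℂ) ^ n := fun a n =>
    continuous_const.mul (continuous_circle_zpow n)
  rw [momentFunctional_eq_sum c j p p.natDegree.lt_succ_self]
  have : ∀ z : Circle, (z : ℂ) ^ (-j) * p.eval (z : ℂ) =
      ∑ k ∈ Finset.range (p.natDegree + 1), p.coeff k * (z : ℂ) ^ ((k : ℤ) - j) := by
    intro z
    rw [eval_eq_sum_range, Finset.mul_sum]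
    refine Finset.sum_congr rfl fun k _ => ?_
    rw [sub_eq_add_neg, zpow_add₀ z.coe_ne_zero, zpow_natCast]
    ring
  simp only [this]
  rw [integral_finsetSum _ fun k _ => integrable_of_continuous_circle (hcont _ _)]
  refine Finset.sum_congr rfl fun k _ => ?_
  rw [integral_const_mul, hc]

/-- Every sequence in the open unit disk is the sequence of Verblunsky coefficients of a probability
measure on the circle. -/
theorem exists_measure_szegoMoment {α : ℕ → ℂ} (hα : ∀ n, ‖α n‖ < 1) :
    ∃ μ : Measure Circle, IsProbabilityMeasure μ ∧ ∀ m : ℤ, ∫ z, (z : ℂ) ^ m ∂μ =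
      szegoMoment α m := by
  refine exists_probabilityMeasure_moments (szegoMoment_zero α) fun N x => ?_
  set p : ℂ[X] := ∑ k ∈ Finset.range N, monomial k (x k) with hp
  have hcoeff : ∀ k ∈ Finset.range N, p.coeff k = x k := by
    intro k hk
    simp only [hp, finsetSum_coeff, coeff_monomial]
    rw [Finset.sum_ite_eq' (Finset.range N) k x, if_pos hk]
  have hdeg : p.degree < N := by
    rw [degree_lt_iff_coeff_zero]
    intro m hm
    simp only [hp, finsetSum_coeff, coeff_monomial]
    refine Finset.sum_eq_zero fun k hk => if_neg ?_
    rw [Finset.mem_range] at hk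
    omega
  obtain ⟨r, hr, h⟩ := toeplitzForm_szegoMoment_nonneg hα N N le_rfl p hdeg
  refine ⟨r, hr, ?_⟩
  rw [← h, toeplitzForm, Finset.sum_comm]
  refine Finset.sum_congr rfl fun j hj => ?_
  have hfun : momentFunctional (szegoMoment α) j p =
      ∑ k ∈ Finset.range N, x k * szegoMoment α (k - j) := by
    simp_rw [hp, map_sum, ← C_mul_X_pow_eq_monomial, momentFunctional_C_mul,
      momentFunctional_X_pow]
  rw [hfun, hcoeff j hj, Finset.mul_sum]
  exact Finset.sum_congr rfl fun k _ => by ring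

/-! ### Trigonometric coefficients from Verblunsky coefficients. -/

section Verblunsky

variable {α : ℕ → ℂ} {μ : Measure Circle} [IsProbabilityMeasure μ]

/-- A measure with Verblunsky coefficients in the open unit disk has infinite support: otherwise
the monic polynomial vanishing on the support is orthogonal to a Szegő polynomial of the same
degree. -/
theorem support_infinite_of_szegoMoment (hα : ∀ n, ‖α n‖ < 1)
    (hμ : ∀ m : ℤ, ∫ z, (z : ℂ) ^ m ∂μ = szegoMoment α m) : μ.support.Infinite := by
  intro hfin
  set P : ℂ[X] := ∏ s ∈ hfin.toFinset, (X - C (s : ℂ)) with hP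
  have hmonic : P.Monic := monic_prod_of_monic _ _ fun s _ => monic_X_sub_C _
  set N := P.natDegree
  have hcont : ∀ (a : ℂ) (n : ℤ), Continuous fun z : Circle =>
      a * ((z : ℂ) ^ n * (szegoPoly α N).eval (z : ℂ)) := fun a n =>
    continuous_const.mul ((continuous_circle_zpow n).mul (continuous_circle_eval _))
  -- Expanding `conj P` instead, only its leading term survives by orthogonality, and the same
  -- integral equals the positive number `szegoNormSq α N`.
  have hzero : ∫ z, conj (P.eval (z : ℂ)) * (szegoPoly α N).eval (z : ℂ) ∂μ = 0 := by
    refine integral_eq_zero_of_ae ?_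
    filter_upwards [Measure.support_mem_ae (μ := μ)] with z hz
    have : P.eval (z : ℂ) = 0 := by
      rw [hP, eval_prod]
      exact Finset.prod_eq_zero (hfin.mem_toFinset.2 hz) (by simp)
    simp [this]
  have hexp : ∀ z : Circle, conj (P.eval (z : ℂ)) * (szegoPoly α N).eval (z : ℂ) =
      ∑ j ∈ Finset.range (N + 1),
        conj (P.coeff j) * ((z : ℂ) ^ (-(j : ℤ)) * (szegoPoly α N).eval (z : ℂ)) := by
    intro z
    rw [eval_eq_sum_range, map_sum, Finset.sum_mul]
    refine Finset.sum_congr rfl fun j _ => ?_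
    rw [map_mul, map_pow, ← Circle.coe_inv_eq_conj, Circle.coe_inv, zpow_neg, zpow_natCast,
      inv_pow, mul_assoc]
  simp only [hexp] at hzero
  rw [integral_finsetSum _ fun k _ => integrable_of_continuous_circle (hcont _ _),
    Finset.sum_range_succ, Finset.sum_eq_zero, zero_add, integral_const_mul,
    integral_zpow_mul_eval hμ, momentFunctional_szegoPoly_self, hmonic.coeff_natDegree, map_one,
    one_mul] at hzero
  · exact (szegoNormSq_pos hα N).ne' (by exact_mod_cast hzero)
  · intro j hj
    rw [integral_const_mul, integral_zpow_mul_eval hμ,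
      momentFunctional_szegoPoly_eq_zero α (Finset.mem_range.1 hj), mul_zero]

/-- The Laurent polynomial `z⁻ⁿ Φ_{2n+1}(z)`, with leading term `z ^ (n + 1)`. -/
noncomputable def szegoLaurent (α : ℕ → ℂ) (n : ℕ) (z : Circle) : ℂ :=
  (z : ℂ) ^ (-(n : ℤ)) * (szegoPoly α (2 * n + 1)).eval (z : ℂ)

theorem continuous_szegoLaurent (α : ℕ → ℂ) (n : ℕ) : Continuous (szegoLaurent α n) :=
  (continuous_circle_zpow _).mul (continuous_circle_eval _)

theorem szegoLaurent_eq (α : ℕ → ℂ) (n : ℕ) (z : Circle) :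
    szegoLaurent α n z = (z : ℂ) ^ (n + 1) +
      ∑ k ∈ Finset.range (2 * n + 1), (szegoPoly α (2 * n + 1)).coeff k * (z : ℂ) ^ ((k : ℤ) - n) := by
  have h1 : (szegoPoly α (2 * n + 1)).coeff (2 * n + 1) = 1 := by
    have := (szegoPoly_monic α (2 * n + 1)).coeff_natDegree
    rwa [szegoPoly_natDegree] at this
  have h : ∀ k : ℕ, (z : ℂ) ^ ((k : ℤ) - n) = (z : ℂ) ^ (-(n : ℤ)) * (z : ℂ) ^ k := fun k => by
    rw [sub_eq_neg_add, zpow_add₀ z.coe_ne_zero, zpow_natCast]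
  rw [szegoLaurent, eval_eq_sum_range, szegoPoly_natDegree, Finset.sum_range_succ, h1, one_mul,
    mul_add, ← h, add_comm, Finset.mul_sum]
  congr 1
  · rw [← zpow_natCast]
    congr 1
    push_cast
    ring
  · refine Finset.sum_congr rfl fun k _ => ?_
    rw [h]
    ring

theorem re_szegoLaurent_sub_mem (α : ℕ → ℂ) (n : ℕ) :
    (fun z => (szegoLaurent α n z).re) - cosFn (n + 1) ∈ trigSpan (2 * n + 1) := by
  have : (fun z => (szegoLaurent α n z).re) - cosFn (n + 1) =
      ∑ k ∈ Finset.range (2 * n + 1), fun z : Circle =>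
        ((szegoPoly α (2 * n + 1)).coeff k * (z : ℂ) ^ ((k : ℤ) - n)).re := by
    funext z
    simp only [Pi.sub_apply, szegoLaurent_eq, Complex.add_re, Complex.re_sum, cosFn,
      Finset.sum_apply, add_sub_cancel_left]
  rw [this]
  refine sum_mem fun k hk => (re_im_mul_zpow_mem_trigSpan _ ?_).1
  rw [Finset.mem_range] at hk
  omega

theorem im_szegoLaurent_sub_mem (α : ℕ → ℂ) (n : ℕ) :
    (fun z => (szegoLaurent α n z).im) - sinFn (n + 1) ∈ trigSpan (2 * n + 1) := by
  have : (fun z => (szegoLaurent α n z).im) - sinFn (n + 1) =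
      ∑ k ∈ Finset.range (2 * n + 1), fun z : Circle =>
        ((szegoPoly α (2 * n + 1)).coeff k * (z : ℂ) ^ ((k : ℤ) - n)).im := by
    funext z
    simp only [Pi.sub_apply, szegoLaurent_eq, Complex.add_im, Complex.im_sum, sinFn,
      Finset.sum_apply, add_sub_cancel_left]
  rw [this]
  refine sum_mem fun k hk => (re_im_mul_zpow_mem_trigSpan _ ?_).2
  rw [Finset.mem_range] at hk
  omega

theorem integral_szegoLaurent_mul_zpow (hμ : ∀ m : ℤ, ∫ z, (z : ℂ) ^ m ∂μ = szegoMoment α m)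
    (n : ℕ) (m : ℤ) : ∫ z, szegoLaurent α n z * (z : ℂ) ^ m ∂μ =
      momentFunctional (szegoMoment α) (n - m) (szegoPoly α (2 * n + 1)) := by
  rw [← integral_zpow_mul_eval hμ]
  refine integral_congr_ae (Eventually.of_forall fun z => ?_)
  simp only [szegoLaurent]
  rw [neg_sub, sub_eq_add_neg, zpow_add₀ z.coe_ne_zero]
  ring

theorem integral_szegoLaurent_mul_cosFn (hμ : ∀ m : ℤ, ∫ z, (z : ℂ) ^ m ∂μ = szegoMoment α m)
    (n k : ℕ) : ∫ z, szegoLaurent α n z * (cosFn k z : ℂ) ∂μ =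
      (momentFunctional (szegoMoment α) (n - k) (szegoPoly α (2 * n + 1)) +
        momentFunctional (szegoMoment α) (n + k) (szegoPoly α (2 * n + 1))) / 2 := by
  have hint : ∀ m : ℤ, Integrable (fun z : Circle => szegoLaurent α n z * (z : ℂ) ^ m) μ :=
    fun m => integrable_of_continuous_circle
      ((continuous_szegoLaurent α n).mul (continuous_circle_zpow m))
  rw [← sub_neg_eq_add (n : ℤ) k, ← integral_szegoLaurent_mul_zpow hμ,
    ← integral_szegoLaurent_mul_zpow hμ, ← integral_add (hint _) (hint _), ← integral_div]
  refine integral_congr_ae (Eventually.of_forall fun z => ?_)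
  simp only [cosFn_eq, zpow_neg, zpow_natCast, inv_pow]
  ring

theorem integral_szegoLaurent_mul_sinFn (hμ : ∀ m : ℤ, ∫ z, (z : ℂ) ^ m ∂μ = szegoMoment α m)
    (n k : ℕ) : ∫ z, szegoLaurent α n z * (sinFn k z : ℂ) ∂μ =
      (momentFunctional (szegoMoment α) (n - k) (szegoPoly α (2 * n + 1)) -
        momentFunctional (szegoMoment α) (n + k) (szegoPoly α (2 * n + 1))) / (2 * Complex.I) := by
  have hint : ∀ m : ℤ, Integrable (fun z : Circle => szegoLaurent α n z * (z : ℂ) ^ m) μ :=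
    fun m => integrable_of_continuous_circle
      ((continuous_szegoLaurent α n).mul (continuous_circle_zpow m))
  rw [← sub_neg_eq_add (n : ℤ) k, ← integral_szegoLaurent_mul_zpow hμ,
    ← integral_szegoLaurent_mul_zpow hμ, ← integral_sub (hint _) (hint _), ← integral_div]
  refine integral_congr_ae (Eventually.of_forall fun z => ?_)
  simp only [sinFn_eq, zpow_neg, zpow_natCast, inv_pow]
  ring

/-- A frequency `k ≤ n` involves only the functionals of indices `n ± k`, which lie in `[0, 2n]`,
where they annihilate `Φ_{2n+1}`. -/
theorem integral_szegoLaurent_mul_trigSystem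
    (hμ : ∀ m : ℤ, ∫ z, (z : ℂ) ^ m ∂μ = szegoMoment α m) {n j : ℕ} (hj : j < 2 * n + 1) :
    ∫ z, szegoLaurent α n z * (trigSystem j z : ℂ) ∂μ = 0 := by
  have hzero : ∀ i : ℤ, 0 ≤ i → i < 2 * n + 1 →
      momentFunctional (szegoMoment α) i (szegoPoly α (2 * n + 1)) = 0 := by
    intro i hi hin
    lift i to ℕ using hi
    exact momentFunctional_szegoPoly_eq_zero α (by omega)
  obtain ⟨k, rfl | rfl⟩ := j.even_or_odd'
  · rw [trigSystem_even, integral_szegoLaurent_mul_cosFn hμ, hzero _ (by omega) (by omega),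
      hzero _ (by omega) (by omega), add_zero, zero_div]
  · rw [trigSystem_odd, integral_szegoLaurent_mul_sinFn hμ, hzero _ (by omega) (by omega),
      hzero _ (by omega) (by omega), sub_zero, zero_div]

theorem realInner_re {f : Circle → ℂ} (hf : Continuous f) {g : Circle → ℝ} (hg : Continuous g) :
    realInner μ (fun z => (f z).re) g = (∫ z, f z * (g z : ℂ) ∂μ).re := by
  have hint : Integrable (fun z => f z * (g z : ℂ)) μ :=
    integrable_of_continuous_circle (hf.mul (Complex.continuous_ofReal.comp hg))
  have := integral_re hint
  simp only [RCLike.re_to_complex, Complex.re_mul_ofReal] at this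
  exact this

theorem realInner_im {f : Circle → ℂ} (hf : Continuous f) {g : Circle → ℝ} (hg : Continuous g) :
    realInner μ (fun z => (f z).im) g = (∫ z, f z * (g z : ℂ) ∂μ).im := by
  have hint : Integrable (fun z => f z * (g z : ℂ)) μ :=
    integrable_of_continuous_circle (hf.mul (Complex.continuous_ofReal.comp hg))
  have := integral_im hint
  simp only [RCLike.im_to_complex, Complex.im_mul_ofReal] at this
  exact this

/-- At frequency `n + 1` the two indices become `-1` and `2n + 1`, just outside the range of
orthogonality; they contribute `conj α * h` and `h`. -/
theorem integral_szegoLaurent_mul_cosFn_succ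
    (hμ : ∀ m : ℤ, ∫ z, (z : ℂ) ^ m ∂μ = szegoMoment α m) (n : ℕ) :
    ∫ z, szegoLaurent α n z * (cosFn (n + 1) z : ℂ) ∂μ =
      (conj (α (2 * n + 1)) + 1) * szegoNormSq α (2 * n + 1) / 2 := by
  rw [integral_szegoLaurent_mul_cosFn hμ,
    show (n : ℤ) - (n + 1 : ℕ) = -1 by push_cast; ring,
    show (n : ℤ) + (n + 1 : ℕ) = (2 * n + 1 : ℕ) by push_cast; ring,
    momentFunctional_szegoPoly_neg_one, momentFunctional_szegoPoly_self]
  ring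

theorem integral_szegoLaurent_mul_sinFn_succ
    (hμ : ∀ m : ℤ, ∫ z, (z : ℂ) ^ m ∂μ = szegoMoment α m) (n : ℕ) :
    ∫ z, szegoLaurent α n z * (sinFn (n + 1) z : ℂ) ∂μ =
      Complex.I * ((1 - conj (α (2 * n + 1))) * szegoNormSq α (2 * n + 1) / 2) := by
  rw [integral_szegoLaurent_mul_sinFn hμ,
    show (n : ℤ) - (n + 1 : ℕ) = -1 by push_cast; ring,
    show (n : ℤ) + (n + 1 : ℕ) = (2 * n + 1 : ℕ) by push_cast; ring,
    momentFunctional_szegoPoly_neg_one, momentFunctional_szegoPoly_self]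
  field_simp
  rw [Complex.I_sq]
  ring

/-- The coefficients of the orthogonal trigonometric polynomials in terms of the Verblunsky
coefficients: here `p`, `q`, `r` are the entries of the Gram matrix of the projections of
`sin ((n + 1) θ)` and `cos ((n + 1) θ)`. -/
theorem coeff_of_szegoMoment (hα : ∀ n, ‖α n‖ < 1)
    (hμ : ∀ m : ℤ, ∫ z, (z : ℂ) ^ m ∂μ = szegoMoment α m) (n : ℕ) {p q r : ℝ}
    (hp : p = szegoNormSq α (2 * n + 1) * (1 - (α (2 * n + 1)).re) / 2)
    (hq : q = -(szegoNormSq α (2 * n + 1) * (α (2 * n + 1)).im) / 2)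
    (hr : r = szegoNormSq α (2 * n + 1) * (1 + (α (2 * n + 1)).re) / 2) :
    coeffB μ (n + 1) = √p ∧ coeffBeta μ (n + 1) = q / p ∧
      coeffA μ (n + 1) = √(r - q ^ 2 / p) := by
  set S : ℕ → Circle → ℝ := fun n z => (szegoLaurent α n z).im with hS
  set K : ℕ → Circle → ℝ := fun n z => (szegoLaurent α n z).re with hK
  have hScont : ∀ n, Continuous (S n) := fun n =>
    Complex.continuous_im.comp (continuous_szegoLaurent α n)
  have hKcont : ∀ n, Continuous (K n) := fun n =>
    Complex.continuous_re.comp (continuous_szegoLaurent α n)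
  have hSlow : ∀ n, ∀ j < 2 * n + 1, realInner μ (S n) (trigSystem j) = 0 := fun n j hj => by
    rw [realInner_im (continuous_szegoLaurent α n) (continuous_trigSystem j),
      integral_szegoLaurent_mul_trigSystem hμ hj, Complex.zero_im]
  have hKlow : ∀ n, ∀ j < 2 * n + 1, realInner μ (K n) (trigSystem j) = 0 := fun n j hj => by
    rw [realInner_re (continuous_szegoLaurent α n) (continuous_trigSystem j),
      integral_szegoLaurent_mul_trigSystem hμ hj, Complex.zero_re]
  have hSS : ∀ n, realInner μ (S n) (sinFn (n + 1)) =
      szegoNormSq α (2 * n + 1) * (1 - (α (2 * n + 1)).re) / 2 := fun n => by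
    rw [realInner_im (continuous_szegoLaurent α n) (continuous_sinFn _),
      integral_szegoLaurent_mul_sinFn_succ hμ]
    simp [Complex.div_ofNat_re, Complex.div_ofNat_im]
    ring
  have hKS : ∀ n, realInner μ (K n) (sinFn (n + 1)) =
      -(szegoNormSq α (2 * n + 1) * (α (2 * n + 1)).im) / 2 := fun n => by
    rw [realInner_re (continuous_szegoLaurent α n) (continuous_sinFn _),
      integral_szegoLaurent_mul_sinFn_succ hμ]
    simp [Complex.div_ofNat_re, Complex.div_ofNat_im]
    ring
  have hSK : ∀ n, realInner μ (S n) (cosFn (n + 1)) =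
      -(szegoNormSq α (2 * n + 1) * (α (2 * n + 1)).im) / 2 := fun n => by
    rw [realInner_im (continuous_szegoLaurent α n) (continuous_cosFn _),
      integral_szegoLaurent_mul_cosFn_succ hμ]
    simp [Complex.div_ofNat_im]
    ring
  have hKK : ∀ n, realInner μ (K n) (cosFn (n + 1)) =
      szegoNormSq α (2 * n + 1) * (1 + (α (2 * n + 1)).re) / 2 := fun n => by
    rw [realInner_re (continuous_szegoLaurent α n) (continuous_cosFn _),
      integral_szegoLaurent_mul_cosFn_succ hμ]
    simp [Complex.div_ofNat_re]
    ring
  have hre : ∀ n, 0 < 1 - (α n).re := fun n => by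
    linarith [(Complex.re_le_norm (α n)).trans_lt (hα n)]
  have hSpos : ∀ n, 0 < realInner μ (S n) (sinFn (n + 1)) := fun n => by
    rw [hSS]
    exact half_pos (mul_pos (szegoNormSq_pos hα _) (hre _))
  -- The Gram determinant is positive since `|α| < 1`; this keeps the cosine functions nonzero after
  -- the sine has been projected out.
  have hdet : ∀ n, realInner μ (K n) (cosFn (n + 1)) * realInner μ (S n) (sinFn (n + 1)) -
      realInner μ (K n) (sinFn (n + 1)) * realInner μ (S n) (cosFn (n + 1)) =
      szegoNormSq α (2 * n + 1) ^ 2 * (1 - ‖α (2 * n + 1)‖ ^ 2) / 4 := fun n => by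
    rw [hSS, hKS, hSK, hKK, Complex.sq_norm, Complex.normSq_apply]
    ring
  set t : ℕ → ℝ := fun n =>
    realInner μ (K n) (sinFn (n + 1)) / realInner μ (S n) (sinFn (n + 1)) with ht
  -- `S n` is already orthogonal to all its predecessors; `K n` still has to lose its component `t
  -- n` along `S n`.
  set W : ℕ → Circle → ℝ := fun k =>
    if k = 0 then cosFn 0 else
      if k % 2 = 1 then S ((k - 1) / 2) else K ((k - 1) / 2) - t ((k - 1) / 2) • S ((k - 1) / 2)
    with hW
  have hW0 : W 0 = cosFn 0 := rfl
  have hWodd : ∀ n, W (2 * n + 1) = S n := fun n => by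
    simp only [hW]
    rw [if_neg (by omega), if_pos (by omega), show (2 * n + 1 - 1) / 2 = n by omega]
  have hWeven : ∀ n, W (2 * (n + 1)) = K n - t n • S n := fun n => by
    simp only [hW]
    rw [if_neg (by omega), if_neg (by omega), show (2 * (n + 1) - 1) / 2 = n by omega]
  have hcases : ∀ k, k = 0 ∨ (∃ n, k = 2 * n + 1) ∨ ∃ n, k = 2 * (n + 1) := fun k => by
    rcases k.even_or_odd' with ⟨n, rfl | rfl⟩
    · rcases n with _ | n
      · exact Or.inl rfl
      · exact Or.inr (Or.inr ⟨n, rfl⟩)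
    · exact Or.inr (Or.inl ⟨n, rfl⟩)
  have hWinner : ∀ n g, Continuous g → realInner μ (W (2 * (n + 1))) g =
      realInner μ (K n) g - t n * realInner μ (S n) g := fun n g hg => by
    rw [hWeven, realInner_comm, realInner_sub_right hg (hKcont n) ((hScont n).const_smul _),
      realInner_smul_right, realInner_comm, realInner_comm _ g]
  have hWcont : ∀ k, Continuous (W k) := fun k => by
    rcases hcases k with rfl | ⟨n, rfl⟩ | ⟨n, rfl⟩
    · exact continuous_cosFn 0
    · rw [hWodd]; exact hScont n
    · rw [hWeven]; exact (hKcont n).sub ((hScont n).const_smul _)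
  have hWspan : ∀ k, W k - trigSystem k ∈ trigSpan k := fun k => by
    rcases hcases k with rfl | ⟨n, rfl⟩ | ⟨n, rfl⟩
    · rw [hW0, trigSystem_zero, sub_self]; exact zero_mem _
    · rw [hWodd, trigSystem_odd]; exact im_szegoLaurent_sub_mem α n
    · rw [hWeven, trigSystem_even, sub_right_comm]
      have hle : trigSpan (2 * n + 1) ≤ trigSpan (2 * (n + 1)) := trigSpan_mono (by omega)
      refine sub_mem (hle (re_szegoLaurent_sub_mem α n)) (Submodule.smul_mem _ _ ?_)
      rw [← sub_add_cancel (S n) (sinFn (n + 1))]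
      refine add_mem (hle (im_szegoLaurent_sub_mem α n)) ?_
      rw [← trigSystem_odd]
      exact trigSystem_mem_trigSpan (by omega)
  have hWorth : ∀ k, ∀ j < k, realInner μ (W k) (trigSystem j) = 0 := fun k j hj => by
    rcases hcases k with rfl | ⟨n, rfl⟩ | ⟨n, rfl⟩
    · omega
    · rw [hWodd]; exact hSlow n j hj
    · rw [hWinner n _ (continuous_trigSystem j)]
      rcases (show j ≤ 2 * n + 1 by omega).lt_or_eq with h | rfl
      · rw [hKlow n j h, hSlow n j h, mul_zero, sub_zero]
      · rw [trigSystem_odd, ht]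
        simp only
        rw [div_mul_cancel₀ _ (hSpos n).ne', sub_self]
  have hWdiag : ∀ n, realInner μ (W (2 * (n + 1))) (trigSystem (2 * (n + 1))) =
      realInner μ (K n) (cosFn (n + 1)) - t n * realInner μ (S n) (cosFn (n + 1)) := fun n => by
    rw [trigSystem_even, hWinner n _ (continuous_cosFn _)]
  have hWpos : ∀ k, realInner μ (W k) (trigSystem k) ≠ 0 := fun k => by
    rcases hcases k with rfl | ⟨n, rfl⟩ | ⟨n, rfl⟩
    · simp [hW0, trigSystem_zero, realInner, cosFn]
    · rw [hWodd, trigSystem_odd]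
      exact (hSpos n).ne'
    · rw [hWdiag]
      intro h
      have h4 := hdet n
      have hsub : realInner μ (K n) (cosFn (n + 1)) * realInner μ (S n) (sinFn (n + 1)) -
          realInner μ (K n) (sinFn (n + 1)) * realInner μ (S n) (cosFn (n + 1)) = 0 := by
        have h5 : t n * realInner μ (S n) (sinFn (n + 1)) = realInner μ (K n) (sinFn (n + 1)) :=
          div_mul_cancel₀ _ (hSpos n).ne'
        rw [← h5]
        linear_combination realInner μ (S n) (sinFn (n + 1)) * h
      rw [hsub] at h4
      have h6 := szegoNormSq_pos hα (2 * n + 1)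
      have h7 : 0 < 1 - ‖α (2 * n + 1)‖ ^ 2 := by
        nlinarith [hα (2 * n + 1), norm_nonneg (α (2 * n + 1))]
      have : 0 < szegoNormSq α (2 * n + 1) ^ 2 * (1 - ‖α (2 * n + 1)‖ ^ 2) / 4 := by positivity
      exact this.ne h4
  have hmonic := monicOTP_eq hWcont hWspan hWorth hWpos
  have hnorm : ∀ k, realNorm μ (W k) = √(realInner μ (W k) (trigSystem k)) := fun k => by
    rw [← realInner_self_eq_trigSystem (hWcont k) (hWorth k) (hWspan k), realNorm, realInner]
    simp only [sq_abs]
    simp only [sq]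
  have hp0 : 0 < p := by
    rw [hp, ← hSS]
    exact hSpos n
  have hB : coeffB μ (n + 1) = √p := by
    rw [coeffB, if_neg n.succ_ne_zero, show 2 * (n + 1) - 1 = 2 * n + 1 by omega, hmonic, hnorm,
      hWodd, trigSystem_odd, hSS, hp]
  refine ⟨hB, ?_, ?_⟩
  · rw [coeffBeta, orthoPi, if_neg n.succ_ne_zero, realInner_smul_right, realInner_smul_right, hB,
      show 2 * (n + 1) - 1 = 2 * n + 1 by omega, hmonic, hWodd, realInner_comm, hSK, ← hq,
      ← mul_assoc, ← mul_inv, Real.mul_self_sqrt hp0.le, inv_mul_eq_div]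
  · rw [coeffA, if_neg n.succ_ne_zero, hmonic, hnorm, hWdiag, hKK, hSK, ← hr, ← hq, ht]
    simp only
    rw [hKS, hSS, ← hp, ← hq]
    congr 2
    ring

end Verblunsky

/-! ### Realization of given triples, and non-uniqueness. -/

/-- The quantity `a² + b² (1 + β²)`. -/
def gramTrace (a b β : ℕ → ℝ) (n : ℕ) : ℝ := a n ^ 2 + b n ^ 2 * (1 + β n ^ 2)

/-- Verblunsky coefficients realizing the triples `(a, b, β)`. Those of odd index, and the moduli of
those of even index, are determined by the triples; `ε` is a sign put on those of positive even
index. -/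
noncomputable def verblunskyOf (a b β : ℕ → ℝ) (ε : ℝ) : ℕ → ℂ
  | 0 => (√(1 - gramTrace a b β 1) : ℝ)
  | k + 1 =>
    if k % 2 = 0 then
      ⟨1 - 2 * b (k / 2 + 1) ^ 2 / gramTrace a b β (k / 2 + 1),
        -(2 * b (k / 2 + 1) ^ 2 * β (k / 2 + 1)) / gramTrace a b β (k / 2 + 1)⟩
    else
      (ε * √(1 - gramTrace a b β (k / 2 + 1) * gramTrace a b β (k / 2 + 2) /
        (4 * a (k / 2 + 1) ^ 2 * b (k / 2 + 1) ^ 2)) : ℝ)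

section Realization

variable {a b β : ℕ → ℝ}

theorem verblunskyOf_odd (a b β : ℕ → ℝ) (ε : ℝ) (n : ℕ) : verblunskyOf a b β ε (2 * n + 1) =
    ⟨1 - 2 * b (n + 1) ^ 2 / gramTrace a b β (n + 1),
      -(2 * b (n + 1) ^ 2 * β (n + 1)) / gramTrace a b β (n + 1)⟩ := by
  rw [verblunskyOf, if_pos (by omega), show 2 * n / 2 = n by omega]

theorem verblunskyOf_even (a b β : ℕ → ℝ) (ε : ℝ) (n : ℕ) : verblunskyOf a b β ε (2 * n + 2) =
    (ε * √(1 - gramTrace a b β (n + 1) * gramTrace a b β (n + 2) /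
      (4 * a (n + 1) ^ 2 * b (n + 1) ^ 2)) : ℝ) := by
  rw [verblunskyOf, if_neg (by omega), show (2 * n + 1) / 2 = n by omega]

theorem gramTrace_pos (ha : ∀ n, 0 < a n) (n : ℕ) : 0 < gramTrace a b β n := by
  have := ha n
  rw [gramTrace]
  positivity

theorem one_sub_sq_verblunskyOf_odd (ha : ∀ n, 0 < a n) (ε : ℝ) (n : ℕ) :
    1 - ‖verblunskyOf a b β ε (2 * n + 1)‖ ^ 2 =
      4 * a (n + 1) ^ 2 * b (n + 1) ^ 2 / gramTrace a b β (n + 1) ^ 2 := by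
  rw [verblunskyOf_odd, Complex.sq_norm, Complex.normSq_apply]
  have h := (gramTrace_pos (b := b) (β := β) ha (n + 1)).ne'
  have hA : gramTrace a b β (n + 1) =
    a (n + 1) ^ 2 + b (n + 1) ^ 2 * (1 + β (n + 1) ^ 2) := rfl
  field_simp
  rw [hA]
  ring

theorem one_sub_sq_verblunskyOf_even (ha : ∀ n, 0 < a n) (hb : ∀ n, 0 < b n)
    (hineq : ∀ n, gramTrace a b β n * gramTrace a b β (n + 1) < 4 * a n ^ 2 * b n ^ 2)
    {ε : ℝ} (hε : ε ^ 2 = 1) (n : ℕ) :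
    1 - ‖verblunskyOf a b β ε (2 * n + 2)‖ ^ 2 =
      gramTrace a b β (n + 1) * gramTrace a b β (n + 2) / (4 * a (n + 1) ^ 2 * b (n + 1) ^ 2) := by
  have h1 := ha (n + 1)
  have h2 := hb (n + 1)
  have h := (div_lt_one (by positivity)).2 (hineq (n + 1))
  rw [verblunskyOf_even, Complex.norm_real, Real.norm_eq_abs, sq_abs, mul_pow, hε, one_mul,
    Real.sq_sqrt (by linarith)]
  ring

theorem one_sub_sq_verblunskyOf_zero (hone : gramTrace a b β 1 ≤ 1) (ε : ℝ) :
    1 - ‖verblunskyOf a b β ε 0‖ ^ 2 = gramTrace a b β 1 := by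
  rw [verblunskyOf, Complex.norm_real, Real.norm_eq_abs, sq_abs, Real.sq_sqrt (by linarith)]
  ring

theorem norm_verblunskyOf_lt_one (ha : ∀ n, 0 < a n) (hb : ∀ n, 0 < b n)
    (hineq : ∀ n, gramTrace a b β n * gramTrace a b β (n + 1) < 4 * a n ^ 2 * b n ^ 2)
    (hone : gramTrace a b β 1 ≤ 1) {ε : ℝ} (hε : ε ^ 2 = 1) (n : ℕ) :
    ‖verblunskyOf a b β ε n‖ < 1 := by
  suffices 0 < 1 - ‖verblunskyOf a b β ε n‖ ^ 2 by
    nlinarith [norm_nonneg (verblunskyOf a b β ε n)]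
  have hA := gramTrace_pos (b := b) (β := β) ha
  rcases n.even_or_odd' with ⟨m, rfl | rfl⟩
  · rcases m with _ | m
    · rw [mul_zero, one_sub_sq_verblunskyOf_zero hone]
      exact hA 1
    · rw [mul_add_one, one_sub_sq_verblunskyOf_even ha hb hineq hε]
      have h1 := ha (m + 1)
      have h2 := hb (m + 1)
      have h3 := hA (m + 1)
      have h4 := hA (m + 2)
      positivity
  · rw [one_sub_sq_verblunskyOf_odd ha]
    have h1 := ha (m + 1)
    have h2 := hb (m + 1)
    have h3 := hA (m + 1)
    positivity

/-- The product telescopes: the factors of indices `2n + 1` and `2n + 2` multiply to `gramTrace (n +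
2) / gramTrace (n + 1)`. -/
theorem szegoNormSq_verblunskyOf (ha : ∀ n, 0 < a n) (hb : ∀ n, 0 < b n)
    (hineq : ∀ n, gramTrace a b β n * gramTrace a b β (n + 1) < 4 * a n ^ 2 * b n ^ 2)
    (hone : gramTrace a b β 1 ≤ 1) {ε : ℝ} (hε : ε ^ 2 = 1) (n : ℕ) :
    szegoNormSq (verblunskyOf a b β ε) (2 * n + 1) = gramTrace a b β (n + 1) := by
  induction n with
  | zero =>
    rw [mul_zero, szegoNormSq_succ, one_sub_sq_verblunskyOf_zero hone]
    simp [szegoNormSq]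
  | succ n ih =>
    rw [mul_add_one, szegoNormSq_succ, one_sub_sq_verblunskyOf_even ha hb hineq hε,
      szegoNormSq_succ, ih, one_sub_sq_verblunskyOf_odd ha]
    have h1 := (ha (n + 1)).ne'
    have h2 := (hb (n + 1)).ne'
    have h3 := (gramTrace_pos (b := b) (β := β) ha (n + 1)).ne'
    field_simp

theorem hasCoefficients_of_verblunskyOf (ha0 : a 0 = 1) (hb0 : b 0 = 1) (hβ0 : β 0 = 0)
    (ha : ∀ n, 0 < a n) (hb : ∀ n, 0 < b n)
    (hineq : ∀ n, gramTrace a b β n * gramTrace a b β (n + 1) < 4 * a n ^ 2 * b n ^ 2)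
    (hone : gramTrace a b β 1 ≤ 1) {ε : ℝ} (hε : ε ^ 2 = 1) {μ : Measure Circle}
    [IsProbabilityMeasure μ]
    (hμ : ∀ m : ℤ, ∫ z, (z : ℂ) ^ m ∂μ = szegoMoment (verblunskyOf a b β ε) m) :
    HasCoefficients μ a b β := by
  have hα := norm_verblunskyOf_lt_one ha hb hineq hone hε
  refine ⟨⟨inferInstance, support_infinite_of_szegoMoment hα hμ⟩, fun n => ?_⟩
  rcases n with _ | n
  · refine ⟨by rw [coeffA, if_pos rfl, ha0], by rw [coeffB, if_pos rfl, hb0], ?_⟩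
    simp [coeffBeta, orthoPi, realInner, hβ0]
  · have hA := (gramTrace_pos (b := b) (β := β) ha (n + 1)).ne'
    have hAdef : gramTrace a b β (n + 1) =
      a (n + 1) ^ 2 + b (n + 1) ^ 2 * (1 + β (n + 1) ^ 2) := rfl
    have hh := szegoNormSq_verblunskyOf ha hb hineq hone hε n
    -- These entries solve `b² = p`, `β = q / p`, `a² = r - q² / p`.
    obtain ⟨h1, h2, h3⟩ := coeff_of_szegoMoment hα hμ n (p := b (n + 1) ^ 2)
      (q := b (n + 1) ^ 2 * β (n + 1)) (r := a (n + 1) ^ 2 + b (n + 1) ^ 2 * β (n + 1) ^ 2)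
      (by rw [hh, verblunskyOf_odd]; field_simp; ring)
      (by rw [hh, verblunskyOf_odd]; field_simp)
      (by rw [hh, verblunskyOf_odd]; field_simp; rw [hAdef]; ring)
    have hb' := (hb (n + 1)).ne'
    refine ⟨?_, ?_, ?_⟩
    · rw [h3, show a (n + 1) ^ 2 + b (n + 1) ^ 2 * β (n + 1) ^ 2 -
        (b (n + 1) ^ 2 * β (n + 1)) ^ 2 / b (n + 1) ^ 2 = a (n + 1) ^ 2 by field_simp; ring,
        Real.sqrt_sq (ha _).le]
    · rw [h1, Real.sqrt_sq (hb _).le]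
    · rw [h2]
      field_simp

/-- The two choices of sign give different measures. -/
theorem ne_of_verblunskyOf (ha : ∀ n, 0 < a n) (hb : ∀ n, 0 < b n)
    (hineq : ∀ n, gramTrace a b β n * gramTrace a b β (n + 1) < 4 * a n ^ 2 * b n ^ 2)
    (hone : gramTrace a b β 1 ≤ 1) {μ ν : Measure Circle} [IsProbabilityMeasure μ]
    [IsProbabilityMeasure ν]
    (hμ : ∀ m : ℤ, ∫ z, (z : ℂ) ^ m ∂μ = szegoMoment (verblunskyOf a b β 1) m)
    (hν : ∀ m : ℤ, ∫ z, (z : ℂ) ^ m ∂ν = szegoMoment (verblunskyOf a b β (-1)) m) : μ ≠ ν := by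
  rintro rfl
  have hodd := fun ε => verblunskyOf_odd a b β ε 0
  have heven := fun ε => verblunskyOf_even a b β ε 0
  simp only [mul_zero, zero_add] at hodd heven
  have hodd' := (hodd 1).trans (hodd (-1)).symm
  have heven₁ := heven 1
  have heven₂ := heven (-1)
  set α := verblunskyOf a b β 1
  set α' := verblunskyOf a b β (-1)
  have hlow : ∀ k < 2, α k = α' k := by
    intro k hk
    interval_cases k
    · rfl
    · exact hodd'
  have hneg : α' 2 = -α 2 := by
    rw [heven₁, heven₂]
    push_cast
    ring
  have hpoly : szegoPoly α 2 = szegoPoly α' 2 := congrArg Prod.fst (szegoPair_congr hlow)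
  have hnorm : szegoNormSq α 2 = szegoNormSq α' 2 :=
    Finset.prod_congr rfl fun k hk => by rw [hlow k (Finset.mem_range.1 hk)]
  -- The first two coefficients agree, so `Φ 2` is common to both. Integrating `z Φ 2` gives `conj
  -- (α 2) * h 2` for one measure and its negative for the other.
  have h1 := integral_zpow_mul_eval hμ (-1) (szegoPoly α 2)
  have h2 := integral_zpow_mul_eval hν (-1) (szegoPoly α 2)
  rw [h1, hpoly, momentFunctional_szegoPoly_neg_one, ← hpoly, momentFunctional_szegoPoly_neg_one,
    ← hnorm, hneg, map_neg] at h2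
  have hpos : (szegoNormSq α 2 : ℂ) ≠ 0 := by
    exact_mod_cast (szegoNormSq_pos (norm_verblunskyOf_lt_one ha hb hineq hone (one_pow 2)) 2).ne'
  have hne : α 2 ≠ 0 := by
    have ha1 := ha 1
    have hb1 := hb 1
    have h := (div_lt_one (by positivity)).2 (hineq 1)
    rw [heven₁, one_mul]
    exact_mod_cast (Real.sqrt_pos.2 (sub_pos.2 h)).ne'
  have hconj : conj (α 2) = 0 := by
    have := mul_right_cancel₀ hpos h2
    linear_combination this / 2
  exact hne (by simpa using hconj)

end Realization

end OTP

theorem theorem3p1 (a b β : ℕ → ℝ)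
    (ha0 : a 0 = 1) (hb0 : b 0 = 1) (hβ0 : β 0 = 0)
    (ha : ∀ n : ℕ, 0 < a n) (hb : ∀ n : ℕ, 0 < b n)
    (hineq : ∀ n : ℕ,
      (a n ^ 2 + b n ^ 2 * (1 + β n ^ 2)) * (a (n + 1) ^ 2 + b (n + 1) ^ 2 * (1 + β (n + 1) ^ 2))
        < 4 * a n ^ 2 * b n ^ 2)
    (hone : a 1 ^ 2 + b 1 ^ 2 * (1 + β 1 ^ 2) ≤ 1) :
    (∃ μ : MeasureTheory.Measure Circle, OTP.HasCoefficients μ a b β) ∧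
      ¬ ∃! μ : MeasureTheory.Measure Circle, OTP.HasCoefficients μ a b β := by
  have hε : (-1 : ℝ) ^ 2 = 1 := by norm_num
  obtain ⟨μ, hμp, hμ⟩ := OTP.exists_measure_szegoMoment
    (OTP.norm_verblunskyOf_lt_one ha hb hineq hone (one_pow 2))
  obtain ⟨ν, hνp, hν⟩ := OTP.exists_measure_szegoMoment
    (OTP.norm_verblunskyOf_lt_one ha hb hineq hone hε)
  have h1 := OTP.hasCoefficients_of_verblunskyOf ha0 hb0 hβ0 ha hb hineq hone (one_pow 2) hμ
  have h2 := OTP.hasCoefficients_of_verblunskyOf ha0 hb0 hβ0 ha hb hineq hone hε hν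
  exact ⟨⟨μ, h1⟩, fun h => OTP.ne_of_verblunskyOf ha hb hineq hone hμ hν (h.unique h1 h2)⟩
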